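/- Let $m\ge 1$ be an integer and let $\varepsilon>0$ satisfy $8\,\varepsilon\ln m<1$ (no upper bound on $\varepsilon$ when $m=1$). Put $k'=\lceil m/\varepsilon^4\rceil$ (so $k'=m/\varepsilon^4$ when this is an integer). There is a number $K$, depending only on $m$ and $\varepsilon$, such that the following holds for every integer $k\ge K$, every finite ground set $N$ with $n=|N|\ge k$, and all functions $f_1,\dots,f_m:2^N\to\mathbb R$ that are monotone ($f_i(B)\le f_i(A)$ for $B\subseteq A$), submodular ($f_i(A\cup\{a\})-f_i(A)\le f_i(B\cup\{a\})-f_i(B)$ for $B\subseteq A$, $a\in N\setminus A$) and normalized ($f_i(\emptyset)=0$). Let $h(A)=\min_{1\le i\le m}f_i(A)$ and $OPT_k=\max_{A\subseteq N,\,|A|\le k}h(A)$. Start with $S_0=\emptyset$ and, for $0\le j<\lfloor k/k'\rfloor$, let $S_{j+1}=S_j\cup X$, where $X\subseteq N\setminus S_j$ is a set of exactly $k'$ elements for which $h(S_j\cup X)$ is largest (ties broken arbitrarily). Then $|S_{\lfloor k/k'\rfloor}|\le k$ and $$h\big(S_{\lfloor k/k'\rfloor}\big)\ \ge\ \Big(1-\frac1e\Big)(1-2\varepsilon)\,OPT_k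 .$$ Moreover, the deterministic algorithm that carries out each step by exhaustive search over all $k'$-element subsets of $N\setminus S_j$, and that accesses the functions only by querying values $f_i(A)$, performs such a greedy run; it makes at most $n^{k'}$ queries in each step, and hence at most $\lfloor k/k'\rfloor\, n^{k'}\le k\,n^{k'}$ queries in total. -/

import Mathlib

namespace MultiSub

/-- A monotone submodular set function on the ground set `N`, normalized by `f ∅ = 0`.
Submodularity is the law of diminishing marginal values. -/
structure IsMonotoneSubmodular {N : Type*} [DecidableEq N] (f : Finset N → ℝ) : Prop where
  empty_eq_zero : f ∅ = 0
  monotone : ∀ B A : Finset N, B ⊆ A → f B ≤ f A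
  submodular : ∀ B A : Finset N, B ⊆ A → ∀ a : N, a ∉ A →
    f (insert a A) - f A ≤ f (insert a B) - f B

/-- The objective `h(A) = min_i f_i(A)` (a genuine minimum, as `Fin m` is finite, when `1 ≤ m`). -/
noncomputable def minObj {m : ℕ} {N : Type*} (f : Fin m → Finset N → ℝ) (A : Finset N) : ℝ :=
  ⨅ i, f i A

/-- The optimal value `OPT_k = max_{|A| ≤ k} min_i f_i(A)`. -/
noncomputable def optValue {m : ℕ} {N : Type*} [Fintype N]
    (f : Fin m → Finset N → ℝ) (k : ℕ) : ℝ :=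
  ((Finset.univ : Finset (Finset N)).filter (fun A => A.card ≤ k)).sup' ⟨∅, by simp⟩ (minObj f)

/-- The tuple size `k' = m / ε ^ 4`, rounded up to an integer. -/
noncomputable def tupleSize (m : ℕ) (ε : ℝ) : ℕ := ⌈(m : ℝ) / ε ^ 4⌉₊

/-- `S 0, S 1, …, S T` is a run of `T` steps of the greedy heuristic: it starts from the empty set,
and each step adds a set `X` of exactly `k'` new elements for which the resulting value of
`h = min_i f_i` is largest. Ties are broken arbitrarily. -/
def IsGreedyRun {m : ℕ} {N : Type*} [DecidableEq N] (f : Fin m → Finset N → ℝ) (k' T : ℕ)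
    (S : ℕ → Finset N) : Prop :=
  S 0 = ∅ ∧ ∀ j < T, ∃ X : Finset N, X.card = k' ∧ Disjoint X (S j) ∧ S (j + 1) = S j ∪ X ∧
    ∀ Y : Finset N, Y.card = k' → Disjoint Y (S j) → minObj f (S j ∪ Y) ≤ minObj f (S j ∪ X)

/-- Deterministic algorithms in the value-oracle model with result in `α`: either return a result,
or ask the oracle for the value `f i A` and continue depending on the answer only. -/
inductive OracleAlg (m : ℕ) (N : Type*) (α : Type*) where
  | done : α → OracleAlg m N α
  | ask : Fin m → Finset N → (ℝ → OracleAlg m N α) → OracleAlg m N α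

namespace OracleAlg

variable {m : ℕ} {N : Type*} {α β : Type*}

/-- The result of an algorithm when the oracle answers according to `f`. -/
def result (f : Fin m → Finset N → ℝ) : OracleAlg m N α → α
  | done a => a
  | ask i A c => result f (c (f i A))

/-- The number of oracle queries an algorithm makes when the oracle answers according to `f`. -/
def queries (f : Fin m → Finset N → ℝ) : OracleAlg m N α → ℕ
  | done _ => 0
  | ask i A c => queries f (c (f i A)) + 1

/-- Sequential composition. -/
def andThen : OracleAlg m N α → (α → OracleAlg m N β) → OracleAlg m N β
  | done a, g => g a
  | ask i A c, g => ask i A (fun v => andThen (c v) g)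

end OracleAlg

/-- Query `f i A` for the indices `i` in a list, and return the smallest answer
(`⊤` for the empty list). -/
noncomputable def askMin {m : ℕ} {N : Type*} (A : Finset N) :
    List (Fin m) → OracleAlg m N (WithTop ℝ)
  | [] => .done ⊤
  | i :: l => .ask i A (fun v => (askMin A l).andThen (fun w => .done (min (v : WithTop ℝ) w)))

/-- Evaluate `h(A) = min_i f_i(A)` with one query for each of the `m` functions. -/
noncomputable def evalMin {m : ℕ} {N : Type*} (A : Finset N) : OracleAlg m N (WithTop ℝ) :=
  askMin A (List.finRange m)

open Classical in
/-- Go through a list of candidate sets, evaluating `h` on each, and return the best set seen,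
where `best` is the best set so far together with its value. -/
noncomputable def scan {m : ℕ} {N : Type*} (best : Finset N × WithTop ℝ) :
    List (Finset N) → OracleAlg m N (Finset N)
  | [] => .done best.1
  | A :: l => (evalMin A).andThen (fun v => scan (if best.2 < v then (A, v) else best) l)

/-- All sets that arise from `S` by adding a `k'`-tuple of new elements. -/
noncomputable def candidates {N : Type*} [Fintype N] [DecidableEq N] (k' : ℕ) (S : Finset N) :
    List (Finset N) :=
  ((Finset.univ \ S).powersetCard k').toList.map (fun X => S ∪ X)

/-- One greedy step from `S`: exhaustive search over all `k'`-tuples of new elements. -/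
noncomputable def greedyStep {m : ℕ} {N : Type*} [Fintype N] [DecidableEq N] (k' : ℕ)
    (S : Finset N) : OracleAlg m N (Finset N) :=
  match candidates k' S with
  | [] => .done S
  | A :: l => (evalMin A).andThen (fun v => scan (A, v) l)

/-- `T` greedy steps, starting from the empty set. -/
noncomputable def greedyAlg {m : ℕ} {N : Type*} [Fintype N] [DecidableEq N] (k' : ℕ) :
    ℕ → OracleAlg m N (Finset N)
  | 0 => .done ∅
  | T + 1 => (greedyAlg k' T).andThen (greedyStep k')

end MultiSub

/-! Each greedy step closes almost a `k'/k` fraction of the gap between `h(S)` and the optimum `V`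
(`exists_progress`). Take an optimal `O` with `k` elements, and contract and rescale every `f i`
with `f i S < V` so that `O` has value at least `k/k'`. It suffices to find `X ⊆ O` with at most
`k'` elements that has value at least `1 - 7ε/4` for all these functions at once
(`exists_proportional_subset`).

A set `H ⊆ O` of at most `ε k'` elements absorbs the large marginal values (`exists_heavy_set`).
Once these are small, random sampling from `O` would concentrate as in a Chernoff bound. The
sampling is derandomized with the potential `∑ exp(-u i X / ε²)` (`exists_sample`), and the union
bound over `m` functions costs only `ε² ln m < ε/8`.

Iterating `⌊k/k'⌋` times shrinks the gap to at most `exp(-(1 - 2ε)) V`, and convexity of `exp` gives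
the stated factor. For the query bound, the factor `m` per candidate is absorbed by `k'!`. -/

namespace MultiSub

open Finset

/-! ### Marginal values of submodular functions -/

section Submodular

variable {N : Type*} [DecidableEq N] {f : Finset N → ℝ}

theorem IsMonotoneSubmodular.nonneg (hf : IsMonotoneSubmodular f) (A : Finset N) : 0 ≤ f A := by
  have h := hf.monotone ∅ A (empty_subset A)
  rwa [hf.empty_eq_zero] at h

theorem IsMonotoneSubmodular.marginal_anti (hf : IsMonotoneSubmodular f) {B A : Finset N}
    (hBA : B ⊆ A) (a : N) : f (insert a A) - f A ≤ f (insert a B) - f B := by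
  by_cases ha : a ∈ A
  · rw [insert_eq_of_mem ha, sub_self]
    exact sub_nonneg.2 (hf.monotone _ _ (subset_insert a B))
  · exact hf.submodular B A hBA a ha

theorem IsMonotoneSubmodular.union_sub_le_sum (hf : IsMonotoneSubmodular f) (X O : Finset N) :
    f (X ∪ O) - f X ≤ ∑ e ∈ O, (f (insert e X) - f X) := by
  induction O using Finset.induction_on with
  | empty => simp
  | insert a O ha ih =>
    rw [sum_insert ha, union_insert]
    have := hf.marginal_anti (subset_union_left : X ⊆ X ∪ O) a
    linarith

theorem IsMonotoneSubmodular.contract (hf : IsMonotoneSubmodular f) (S : Finset N) {τ : ℝ}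
    (hτ : 0 < τ) : IsMonotoneSubmodular fun X => (f (S ∪ X) - f S) / τ where
  empty_eq_zero := by simp
  monotone B A h := by
    have := hf.monotone _ _ (union_subset_union_right h : S ∪ B ⊆ S ∪ A)
    gcongr
  submodular B A h a _ := by
    have := hf.marginal_anti (union_subset_union_right h : S ∪ B ⊆ S ∪ A) a
    rw [union_insert, union_insert, ← sub_div, ← sub_div,
      div_le_div_iff_of_pos_right hτ]
    linarith

end Submodular

/-! ### Two inequalities for the exponential -/

/-- Follows from `(1 + y + y²/2)(1 - y + y²/2) = 1 + y⁴/4 ≥ 1`. -/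
theorem exp_neg_le_quadratic {y : ℝ} (hy : 0 ≤ y) : Real.exp (-y) ≤ 1 - y + y ^ 2 / 2 := by
  have h := Real.quadratic_le_exp_of_nonneg hy
  rw [Real.exp_neg, inv_le_iff_one_le_mul₀ (Real.exp_pos y)]
  have h0 : 0 ≤ 1 - y + y ^ 2 / 2 := by nlinarith [sq_nonneg (y - 1)]
  nlinarith [mul_le_mul_of_nonneg_left h h0, sq_nonneg (y ^ 2)]

/-- By convexity, `exp` lies below its chord on `[-1, 0]`. -/
theorem one_sub_inv_exp_mul_le {x : ℝ} (h0 : 0 ≤ x) (h1 : x ≤ 1) :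
    (1 - 1 / Real.exp 1) * x ≤ 1 - Real.exp (-x) := by
  have h := convexOn_exp.2 (Set.mem_univ (0 : ℝ)) (Set.mem_univ (-1 : ℝ))
    (sub_nonneg.2 h1) h0 (by ring)
  simp only [smul_eq_mul, mul_zero, zero_add, mul_neg, mul_one, Real.exp_zero] at h
  rw [Real.exp_neg 1] at h
  rw [one_div]
  linarith

/-! ### Selecting a small, proportionally good part of `O` -/

section Selection

variable {N ι : Type*} [DecidableEq N] [Fintype ι] {u : ι → Finset N → ℝ} {ε : ℝ}

/-- A small subset of `O` after which no element of `O` has a large marginal value for a function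
that is still below the threshold `r`. -/
theorem exists_heavy_set (hu : ∀ i, IsMonotoneSubmodular (u i)) (O : Finset N) {δ r : ℝ}
    (hδ : 0 < δ) (hr : r ≤ 1 - δ) :
    ∃ H ⊆ O, (#H : ℝ) * δ ≤ Fintype.card ι ∧
      ∀ i, u i H < r → ∀ e ∈ O, u i (insert e H) - u i H < δ := by
  classical
  have hne : (O.powerset.filter fun H => (#H : ℝ) * δ ≤ ∑ i, min (u i H) 1).Nonempty :=
    ⟨∅, by simp [(hu _).empty_eq_zero]⟩
  obtain ⟨H, hH, hmax⟩ := exists_max_image _ card hne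
  simp only [mem_filter, mem_powerset] at hH hmax
  refine ⟨H, hH.1, hH.2.trans ?_, fun i hi e he => ?_⟩
  · calc ∑ i, min (u i H) 1 ≤ ∑ _i : ι, (1 : ℝ) := sum_le_sum fun i _ => min_le_right _ _
      _ = Fintype.card ι := by simp
  · by_contra! hlt
    have heH : e ∉ H := fun h => by
      rw [insert_eq_of_mem h, sub_self] at hlt
      linarith
    have hcard : #(insert e H) = #H + 1 := card_insert_of_notMem heH
    have hgain : ∑ j, min (u j H) 1 + δ ≤ ∑ j, min (u j (insert e H)) 1 := by
      rw [← add_sum_erase _ _ (mem_univ i), ← add_sum_erase univ (fun j => min (u j (insert e H)) 1)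
        (mem_univ i)]
      -- Truncation at `1` does not eat the gain, since `u i H < r ≤ 1 - δ`.
      have h1 : min (u i H) 1 + δ ≤ min (u i (insert e H)) 1 :=
        le_min (by linarith [min_le_left (u i H) 1]) (by linarith [min_le_left (u i H) 1])
      have h2 : ∑ j ∈ univ.erase i, min (u j H) 1 ≤ ∑ j ∈ univ.erase i, min (u j (insert e H)) 1 :=
        sum_le_sum fun j _ => min_le_min_right _ ((hu j).monotone _ _ (subset_insert e H))
      linarith
    have := hmax (insert e H) ⟨insert_subset he hH.1, by
      rw [hcard]; push_cast; linarith [hH.2]⟩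
    omega

/-- One step of derandomized sampling for a single function. -/
theorem sum_exp_le {v : Finset N → ℝ} (hv : IsMonotoneSubmodular v) (hε : 0 < ε) (hε2 : ε ≤ 1 / 2)
    {O X : Finset N} {p : ℝ} (hp : #O * p ≤ v O - v X)
    (hlight : ∀ e ∈ O, v (insert e X) - v X ≤ ε ^ 3) :
    ∑ e ∈ O, Real.exp (-(v (insert e X) / ε ^ 2)) ≤
      #O * (Real.exp (-(v X / ε ^ 2)) * Real.exp (-((1 - ε / 2) * p / ε ^ 2))) := by
  have hε' : 0 < ε ^ 2 := by positivity
  have hterm : ∀ e ∈ O, Real.exp (-(v (insert e X) / ε ^ 2)) ≤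
      Real.exp (-(v X / ε ^ 2)) * (1 - (1 - ε / 2) * ((v (insert e X) - v X) / ε ^ 2)) := by
    intro e he
    have hsplit : -(v (insert e X) / ε ^ 2) =
        -(v X / ε ^ 2) + -((v (insert e X) - v X) / ε ^ 2) := by ring
    rw [hsplit, Real.exp_add]
    have h0 : 0 ≤ (v (insert e X) - v X) / ε ^ 2 :=
      div_nonneg (sub_nonneg.2 (hv.monotone _ _ (subset_insert e X))) hε'.le
    have h1 : (v (insert e X) - v X) / ε ^ 2 ≤ ε := by
      rw [div_le_iff₀ hε']
      calc _ ≤ ε ^ 3 := hlight e he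
        _ = ε * ε ^ 2 := by ring
    gcongr
    -- For `0 ≤ y ≤ ε` the quadratic term satisfies `y²/2 ≤ (ε/2) y`.
    refine (exp_neg_le_quadratic h0).trans ?_
    nlinarith
  refine (sum_le_sum hterm).trans ?_
  rw [← mul_sum, mul_left_comm]
  gcongr
  have hsum : #O * p ≤ ∑ e ∈ O, (v (insert e X) - v X) := by
    refine hp.trans (le_trans ?_ (hv.union_sub_le_sum X O))
    linarith [hv.monotone O (X ∪ O) subset_union_right]
  calc ∑ e ∈ O, (1 - (1 - ε / 2) * ((v (insert e X) - v X) / ε ^ 2))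
      = #O - (1 - ε / 2) * ((∑ e ∈ O, (v (insert e X) - v X)) / ε ^ 2) := by
        rw [sum_sub_distrib, ← mul_sum, ← sum_div]; simp
    _ ≤ #O - (1 - ε / 2) * ((#O * p) / ε ^ 2) := by
        have : 0 ≤ 1 - ε / 2 := by linarith
        gcongr
    _ = #O * (-((1 - ε / 2) * p / ε ^ 2) + 1) := by ring
    _ ≤ _ := by
        gcongr
        exact Real.add_one_le_exp _

open Classical in
/-- Derandomized sampling of `t` elements of `O` on top of `H`: the exponential potential of the
functions still below `r` decays geometrically. -/
theorem exists_sample (hu : ∀ i, IsMonotoneSubmodular (u i)) (hε : 0 < ε) (hε2 : ε ≤ 1 / 2)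
    {O H : Finset N} (hO : O.Nonempty) (hHO : H ⊆ O) {p r : ℝ} (hp : ∀ i, #O * p ≤ u i O - r)
    (hlight : ∀ i, u i H < r → ∀ e ∈ O, u i (insert e H) - u i H < ε ^ 3) (t : ℕ) :
    ∃ X ⊆ O, H ⊆ X ∧ #X ≤ #H + t ∧
      ∑ i with u i X < r, Real.exp (-(u i X / ε ^ 2)) ≤
        Fintype.card ι * Real.exp (-((1 - ε / 2) * p / ε ^ 2)) ^ t := by
  induction t with
  | zero =>
    refine ⟨H, hHO, Subset.rfl, le_rfl, ?_⟩
    rw [pow_zero, mul_one]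
    calc ∑ i with u i H < r, Real.exp (-(u i H / ε ^ 2))
        ≤ ∑ i with u i H < r, (1 : ℝ) := sum_le_sum fun i _ => by
          rw [Real.exp_le_one_iff]
          have := (hu i).nonneg H
          have : 0 ≤ u i H / ε ^ 2 := by positivity
          linarith
      _ ≤ ∑ _i : ι, (1 : ℝ) := sum_le_sum_of_subset_of_nonneg (filter_subset _ _)
          fun _ _ _ => zero_le_one
      _ = Fintype.card ι := by simp
  | succ t ih =>
    obtain ⟨X, hXO, hHX, hcard, hpot⟩ := ih
    set q := Real.exp (-((1 - ε / 2) * p / ε ^ 2)) with hq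
    -- Some `e ∈ O` does at least as well as the average over `O`. Submodularity keeps the marginals
    -- small after passing from `H` to `X`.
    have havg : ∑ e ∈ O, ∑ i with u i X < r, Real.exp (-(u i (insert e X) / ε ^ 2)) ≤
        ∑ _e ∈ O, (∑ i with u i X < r, Real.exp (-(u i X / ε ^ 2))) * q := by
      rw [sum_comm, sum_const, nsmul_eq_mul, sum_mul, mul_sum]
      refine sum_le_sum fun i hi => ?_
      have hi' : u i X < r := (mem_filter.1 hi).2
      refine sum_exp_le (hu i) hε hε2 ((hp i).trans (by linarith)) fun e he => ?_
      exact ((hu i).marginal_anti hHX e).trans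
        (hlight i (((hu i).monotone _ _ hHX).trans_lt hi') e he).le
    obtain ⟨e, he, hle⟩ := exists_le_of_sum_le hO havg
    refine ⟨insert e X, insert_subset he hXO, hHX.trans (subset_insert e X),
      (card_insert_le e X).trans (by omega), ?_⟩
    -- Functions that reach `r` leave the sum, which only lowers the potential.
    calc ∑ i with u i (insert e X) < r, Real.exp (-(u i (insert e X) / ε ^ 2))
        ≤ ∑ i with u i X < r, Real.exp (-(u i (insert e X) / ε ^ 2)) :=
          sum_le_sum_of_subset_of_nonneg
            (monotone_filter_right _ fun i _ hi =>
              ((hu i).monotone _ _ (subset_insert e X)).trans_lt hi)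
            fun _ _ _ => (Real.exp_pos _).le
      _ ≤ _ := hle
      _ ≤ Fintype.card ι * q ^ t * q := by gcongr
      _ = _ := by ring

/-- A proportional part of `O`, of size `k'`, is almost proportionally good for all functions at
once. -/
theorem exists_proportional_subset (hu : ∀ i, IsMonotoneSubmodular (u i)) (hε : 0 < ε)
    (hε2 : ε ≤ 1 / 2) {m k' : ℕ} (hι : Fintype.card ι ≤ m) (hm : 1 ≤ m)
    (hεm : 8 * ε * Real.log m < 1) (hk' : m / ε ^ 4 ≤ (k' : ℝ)) {O : Finset N}
    (hO : 8 * (k' : ℝ) ≤ ε * #O) (huO : ∀ i, (#O : ℝ) / k' ≤ u i O) :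
    ∃ X ⊆ O, #X ≤ k' ∧ ∀ i, 1 - 7 / 4 * ε ≤ u i X := by
  classical
  have hm0 : (0 : ℝ) < m := by exact_mod_cast hm
  have hk0 : (0 : ℝ) < k' := lt_of_lt_of_le (by positivity) hk'
  have hO0 : (0 : ℝ) < #O := by
    by_contra! h
    nlinarith
  have hOne : O.Nonempty := card_pos.1 (by exact_mod_cast hO0)
  have hε3 : ε ^ 3 ≤ 7 / 4 * ε := by nlinarith [pow_pos hε 2]
  obtain ⟨H, hHO, hHcard, hlight⟩ :=
    exists_heavy_set hu O (pow_pos hε 3) (r := 1 - 7 / 4 * ε) (by linarith)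
  have hHk : (#H : ℝ) ≤ ε * k' := by
    have h1 : (m : ℝ) ≤ k' * ε ^ 4 := by rwa [div_le_iff₀ (by positivity)] at hk'
    have h2 : (#H : ℝ) * ε ^ 3 ≤ (ε * k') * ε ^ 3 := by
      calc _ ≤ (Fintype.card ι : ℝ) := hHcard
        _ ≤ m := by exact_mod_cast hι
        _ ≤ _ := by linarith
    exact le_of_mul_le_mul_right h2 (by positivity)
  have hHk' : #H ≤ k' := by
    have : (#H : ℝ) ≤ k' := hHk.trans (by nlinarith)
    exact_mod_cast this
  -- With this `p`, `#O * p = #O / k' - 1`; the `-1` pays for the threshold `r ≤ 1`.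
  obtain ⟨X, hXO, -, hXcard, hpot⟩ := exists_sample hu hε hε2 hOne hHO
    (p := 1 / k' - 1 / #O) (r := 1 - 7 / 4 * ε)
    (fun i => by
      have : (#O : ℝ) * (1 / k' - 1 / #O) = #O / k' - 1 := by field_simp
      rw [this]
      linarith [huO i]) hlight (k' - #H)
  refine ⟨X, hXO, by omega, fun i => ?_⟩
  by_contra! hi
  have hterm : Real.exp (-(u i X / ε ^ 2)) ≤
      ∑ i with u i X < 1 - 7 / 4 * ε, Real.exp (-(u i X / ε ^ 2)) :=
    single_le_sum (f := fun i => Real.exp (-(u i X / ε ^ 2))) (fun _ _ => (Real.exp_pos _).le)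
      (by simpa using hi)
  have hbound := hterm.trans hpot
  have hm' : (Fintype.card ι : ℝ) ≤ Real.exp (Real.log m) := by
    rw [Real.exp_log hm0]
    exact_mod_cast hι
  have hlog : -(u i X / ε ^ 2) ≤
      Real.log m + (k' - #H : ℕ) * -((1 - ε / 2) * (1 / k' - 1 / #O) / ε ^ 2) := by
    rw [← Real.exp_le_exp, Real.exp_add, Real.exp_nat_mul]
    exact hbound.trans (by gcongr)
  rw [Nat.cast_sub hHk'] at hlog
  have hp : (1 - ε / 8) / k' ≤ 1 / k' - 1 / (#O : ℝ) := by
    have : 1 / (#O : ℝ) ≤ ε / 8 / k' := by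
      rw [div_le_div_iff₀ hO0 hk0]
      linarith
    rw [sub_div]
    linarith
  have hsteps : (1 - ε) * (1 - ε / 8) ≤ ((k' : ℝ) - #H) * (1 / k' - 1 / #O) := by
    calc (1 - ε) * (1 - ε / 8) = ((1 - ε) * k') * ((1 - ε / 8) / k') := by field_simp
      _ ≤ _ := by
        have : 0 ≤ 1 - ε / 8 := by linarith
        have : (1 - ε) * k' ≤ (k' : ℝ) - #H := by linarith
        have : (0 : ℝ) ≤ (k' : ℝ) - #H := sub_nonneg.2 (by exact_mod_cast hHk')
        gcongr
  have hmul : (1 - ε / 2) * (((k' : ℝ) - #H) * (1 / k' - 1 / #O)) ≤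
      ε ^ 2 * Real.log m + u i X := by
    have := mul_le_mul_of_nonneg_right hlog (sq_nonneg ε)
    field_simp at this ⊢
    linarith
  have hlow := mul_le_mul_of_nonneg_left hsteps (by linarith : 0 ≤ 1 - ε / 2)
  have : ε ^ 2 * Real.log m ≤ ε / 8 := by nlinarith
  -- The losses `ε/2`, `ε`, `ε/8` (product) and `ε/8` (logarithm) add up to `7ε/4`.
  nlinarith [pow_pos hε 2, mul_pos hε hε, pow_pos hε 3]

end Selection

/-! ### The objective and the greedy recursion -/

section Objective

variable {m : ℕ} {N : Type*} {f : Fin m → Finset N → ℝ}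

theorem minObj_le (f : Fin m → Finset N → ℝ) (A : Finset N) (i : Fin m) : minObj f A ≤ f i A :=
  ciInf_le (Set.finite_range _).bddBelow i

theorem le_minObj (hm : 1 ≤ m) {A : Finset N} {c : ℝ} (h : ∀ i, c ≤ f i A) : c ≤ minObj f A :=
  have : Nonempty (Fin m) := ⟨⟨0, hm⟩⟩
  le_ciInf h

variable [DecidableEq N]

theorem minObj_mono (hm : 1 ≤ m) (hf : ∀ i, IsMonotoneSubmodular (f i)) {A B : Finset N}
    (h : A ⊆ B) : minObj f A ≤ minObj f B :=
  le_minObj hm fun i => (minObj_le f A i).trans ((hf i).monotone _ _ h)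

theorem minObj_nonneg (hm : 1 ≤ m) (hf : ∀ i, IsMonotoneSubmodular (f i)) (A : Finset N) :
    0 ≤ minObj f A :=
  le_minObj hm fun i => (hf i).nonneg A

theorem IsGreedyRun.card_eq {k' T : ℕ} {S : ℕ → Finset N} (h : IsGreedyRun f k' T S) {j : ℕ}
    (hj : j ≤ T) : #(S j) = j * k' := by
  induction j with
  | zero => simp [h.1]
  | succ j ih =>
    obtain ⟨X, hX, hdisj, hS, -⟩ := h.2 j hj
    rw [hS, card_union_of_disjoint hdisj.symm, ih (by omega), hX]
    ring

variable [Fintype N]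

theorem optValue_nonneg (hm : 1 ≤ m) (hf : ∀ i, IsMonotoneSubmodular (f i)) (k : ℕ) :
    0 ≤ optValue f k :=
  (minObj_nonneg hm hf ∅).trans (le_sup' (minObj f) (by simp))

theorem exists_card_eq_optValue_le (hm : 1 ≤ m) (hf : ∀ i, IsMonotoneSubmodular (f i)) {k : ℕ}
    (hk : k ≤ Fintype.card N) : ∃ O : Finset N, #O = k ∧ ∀ i, optValue f k ≤ f i O := by
  obtain ⟨A, hA, hAopt⟩ := exists_mem_eq_sup' (s := (univ : Finset (Finset N)).filter
    fun A => #A ≤ k) ⟨∅, by simp⟩ (minObj f)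
  obtain ⟨O, hAO, -, hO⟩ := exists_subsuperset_card_eq (subset_univ A) (mem_filter.1 hA).2
    (by simpa using hk)
  refine ⟨O, hO, fun i => ?_⟩
  calc optValue f k = minObj f A := hAopt
    _ ≤ minObj f O := minObj_mono hm hf hAO
    _ ≤ f i O := minObj_le f O i

/-- A greedy step needs exactly `k'` new elements, while the selected `X` may be smaller and may
meet `S`; padding is harmless by monotonicity. -/
theorem exists_extension {k' : ℕ} {S X : Finset N} (hX : #X ≤ k')
    (hS : #S + k' ≤ Fintype.card N) :
    ∃ Y : Finset N, #Y = k' ∧ Disjoint Y S ∧ S ∪ X ⊆ S ∪ Y := by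
  obtain ⟨Y, hXY, hYS, hY⟩ := exists_subsuperset_card_eq
    (sdiff_subset_sdiff (subset_univ X) Subset.rfl : X \ S ⊆ univ \ S)
    ((card_le_card sdiff_subset).trans hX)
    (by rw [card_sdiff_of_subset (subset_univ S), card_univ]; omega)
  refine ⟨Y, hY, disjoint_left.2 fun a ha => (mem_sdiff.1 (hYS ha)).2, ?_⟩
  rw [← union_sdiff_self_eq_union]
  exact union_subset_union_right hXY

/-- Progress of one greedy step. -/
theorem exists_progress (hm : 1 ≤ m) (hf : ∀ i, IsMonotoneSubmodular (f i)) {ε : ℝ} (hε : 0 < ε)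
    (hε2 : ε ≤ 1 / 2) (hεm : 8 * ε * Real.log m < 1) {k k' : ℕ} (hk' : m / ε ^ 4 ≤ (k' : ℝ))
    (hkk : 8 * (k' : ℝ) ≤ ε * k) (hkN : k ≤ Fintype.card N) {S : Finset N}
    (hS : #S + k' ≤ Fintype.card N) :
    ∃ Y : Finset N, #Y = k' ∧ Disjoint Y S ∧
      minObj f S + (1 - 7 / 4 * ε) * (k' / k) * (optValue f k - minObj f S) ≤
        minObj f (S ∪ Y) := by
  have hm0 : (0 : ℝ) < m := by exact_mod_cast hm
  have hk0 : (0 : ℝ) < k' := lt_of_lt_of_le (by positivity) hk'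
  have hkpos : (0 : ℝ) < k := by
    by_contra! h
    nlinarith
  have hle : (k' : ℝ) / k ≤ 1 := by
    rw [div_le_one hkpos]
    nlinarith
  obtain ⟨O, hO, hopt⟩ := exists_card_eq_optValue_le hm hf hkN
  set V := optValue f k
  -- Only functions below `V` have a gap to close. Dividing by the target gain `k'/k * (V - f i S)`
  -- gives `O` value at least `k/k'`.
  have hτ : ∀ i : {i // f i S < V}, 0 < k' / k * (V - f i S) := fun i =>
    mul_pos (by positivity) (sub_pos.2 i.2)
  obtain ⟨X, -, hX, hgain⟩ := exists_proportional_subset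
    (u := fun (i : {i // f i S < V}) X => (f i (S ∪ X) - f i S) / (k' / k * (V - f i S)))
    (fun i => (hf i).contract S (hτ i)) hε hε2
    ((Fintype.card_subtype_le _).trans_eq (Fintype.card_fin m)) hm hεm hk' (O := O)
    (by rwa [hO]) (fun i => by
      rw [hO, le_div_iff₀ (hτ i), ← mul_assoc, div_mul_div_cancel₀ hk0.ne', div_self hkpos.ne',
        one_mul]
      linarith [hopt i, (hf i).monotone O (S ∪ O) subset_union_right])
  obtain ⟨Y, hY, hYS, hXY⟩ := exists_extension hX hS
  refine ⟨Y, hY, hYS, le_trans (le_minObj hm fun i => ?_) (minObj_mono hm hf hXY)⟩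
  set q := (1 - 7 / 4 * ε) * ((k' : ℝ) / k) with hq
  have hq0 : 0 ≤ q := mul_nonneg (by linarith) (by positivity)
  have hq1 : q ≤ 1 := by
    have : 0 ≤ (k' : ℝ) / k := by positivity
    nlinarith
  have hc := minObj_le f S i
  have hmono := (hf i).monotone S (S ∪ X) subset_union_left
  have hstep : f i S + q * (V - f i S) ≤ f i (S ∪ X) := by
    by_cases hi : f i S < V
    · have h := hgain ⟨i, hi⟩
      rw [le_div_iff₀ (hτ ⟨i, hi⟩)] at h
      simp only at h
      rw [hq, mul_assoc]
      linarith
    · nlinarith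
  -- Since `q ≤ 1`, `x + q * (V - x)` is nondecreasing in `x`, so `f i S` may be replaced by the
  -- smaller `minObj f S`.
  nlinarith

theorem IsGreedyRun.le_minObj (hm : 1 ≤ m) (hf : ∀ i, IsMonotoneSubmodular (f i)) {ε : ℝ}
    (hε : 0 < ε) (hε2 : ε ≤ 1 / 2) (hεm : 8 * ε * Real.log m < 1) {k k' : ℕ}
    (hk' : m / ε ^ 4 ≤ (k' : ℝ)) (hkk : 8 * (k' : ℝ) ≤ ε * k) (hkN : k ≤ Fintype.card N)
    {S : ℕ → Finset N} (h : IsGreedyRun f k' (k / k') S) :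
    (1 - 1 / Real.exp 1) * (1 - 2 * ε) * optValue f k ≤ minObj f (S (k / k')) := by
  have hm0 : (0 : ℝ) < m := by exact_mod_cast hm
  have hk0 : (0 : ℝ) < k' := lt_of_lt_of_le (by positivity) hk'
  have hkpos : (0 : ℝ) < k := by
    by_contra! h
    nlinarith
  have hV := optValue_nonneg hm hf k
  set q := (1 - 7 / 4 * ε) * ((k' : ℝ) / k) with hq
  have hle : (k' : ℝ) / k ≤ ε / 8 := by
    rw [div_le_iff₀ hkpos]
    linarith
  have hk'k : 0 < (k' : ℝ) / k := by positivity
  have hq1 : 0 ≤ 1 - q := by nlinarith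
  have hrec : ∀ j ≤ k / k', optValue f k - minObj f (S j) ≤ (1 - q) ^ j * optValue f k := by
    intro j hj
    induction j with
    | zero => linarith [minObj_nonneg hm hf (S 0)]
    | succ j ih =>
      have hcard : #(S j) + k' ≤ Fintype.card N := by
        rw [h.card_eq (by omega)]
        calc j * k' + k' = (j + 1) * k' := by ring
          _ ≤ k / k' * k' := Nat.mul_le_mul_right _ hj
          _ ≤ k := Nat.div_mul_le_self k k'
          _ ≤ _ := hkN
      obtain ⟨X, -, -, hS, hbest⟩ := h.2 j hj
      obtain ⟨Y, hY, hYS, hprog⟩ := exists_progress hm hf hε hε2 hεm hk' hkk hkN hcard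
      have h1 := hprog.trans (hbest Y hY hYS)
      rw [← hS, ← hq] at h1
      have h2 := mul_le_mul_of_nonneg_left (ih (by omega)) hq1
      rw [pow_succ']
      linarith
  -- Rounding down `k / k'` loses less than one step, a fraction `k'/k ≤ ε/8`; with `7ε/4` per step
  -- the loss stays below `2ε`.
  have hT : 1 - 2 * ε ≤ (k / k' : ℕ) * q := by
    have h1 : (k : ℝ) < (k / k' : ℕ) * k' + k' := by
      have := Nat.lt_div_mul_add (a := k) (b := k') (by exact_mod_cast hk0)
      exact_mod_cast this
    have h2 : 1 - ε / 8 ≤ (k / k' : ℕ) * ((k' : ℝ) / k) := by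
      rw [mul_div_assoc', le_div_iff₀ hkpos]
      linarith
    have h3 := mul_le_mul_of_nonneg_left h2 (by linarith : 0 ≤ 1 - 7 / 4 * ε)
    rw [hq]
    nlinarith
  have hexp : (1 - q) ^ (k / k') ≤ Real.exp (-(1 - 2 * ε)) := by
    calc (1 - q) ^ (k / k') ≤ Real.exp (-q) ^ (k / k') := by
          gcongr
          linarith [Real.add_one_le_exp (-q)]
      _ = Real.exp ((k / k' : ℕ) * -q) := (Real.exp_nat_mul _ _).symm
      _ ≤ _ := by
          gcongr
          linarith
  have hfin := one_sub_inv_exp_mul_le (x := 1 - 2 * ε) (by linarith) (by linarith)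
  have h1 := mul_le_mul_of_nonneg_right hfin hV
  have h2 := mul_le_mul_of_nonneg_right hexp hV
  linarith [hrec _ le_rfl]

end Objective

/-! ### Semantics of oracle algorithms -/

namespace OracleAlg

variable {m : ℕ} {N α β : Type*} (f : Fin m → Finset N → ℝ)

@[simp]
theorem result_andThen (x : OracleAlg m N α) (g : α → OracleAlg m N β) :
    (x.andThen g).result f = (g (x.result f)).result f := by
  induction x with
  | done a => rfl
  | ask i A c ih => exact ih _

@[simp]
theorem queries_andThen (x : OracleAlg m N α) (g : α → OracleAlg m N β) :
    (x.andThen g).queries f = x.queries f + (g (x.result f)).queries f := by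
  induction x with
  | done a => simp [andThen, queries, result]
  | ask i A c ih =>
    simp only [andThen, queries, result, ih]
    omega

end OracleAlg

/-! ### Correctness and query count of the exhaustive search -/

section Algorithm

variable {m : ℕ} {N : Type*} (f : Fin m → Finset N → ℝ)

theorem queries_askMin (A : Finset N) (l : List (Fin m)) : (askMin A l).queries f = l.length := by
  induction l with
  | nil => rfl
  | cons i l ih => simp [askMin, OracleAlg.queries, ih]

theorem le_result_askMin {c : WithTop ℝ} (A : Finset N) (l : List (Fin m)) :
    c ≤ (askMin A l).result f ↔ ∀ i ∈ l, c ≤ f i A := by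
  induction l with
  | nil => simp [askMin, OracleAlg.result]
  | cons i l ih => simp [askMin, OracleAlg.result, ih]

theorem queries_evalMin (A : Finset N) : (evalMin A).queries f = m := by
  simp [evalMin, queries_askMin]

theorem result_evalMin (hm : 1 ≤ m) (A : Finset N) :
    (evalMin A).result f = (minObj f A : WithTop ℝ) := by
  refine eq_of_forall_le_iff fun c => ?_
  rw [evalMin, le_result_askMin]
  refine ⟨fun h => ?_, fun h i _ => h.trans (WithTop.coe_le_coe.2 (minObj_le f A i))⟩
  cases c with
  -- The list of indices is nonempty, so the default `⊤` is never the answer.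
  | top => simpa using h ⟨0, hm⟩ (List.mem_finRange _)
  | coe c =>
    exact WithTop.coe_le_coe.2
      (le_minObj hm fun i => WithTop.coe_le_coe.1 (h i (List.mem_finRange i)))

theorem queries_scan (l : List (Finset N)) (best : Finset N × WithTop ℝ) :
    (scan best l).queries f = l.length * m := by
  induction l generalizing best with
  | nil => simp [scan, OracleAlg.queries]
  | cons A l ih =>
    simp only [scan, OracleAlg.queries_andThen, queries_evalMin, ih, List.length_cons]
    ring

theorem result_scan (hm : 1 ≤ m) (l : List (Finset N)) (B : Finset N) :
    (scan (B, (minObj f B : WithTop ℝ)) l).result f ∈ B :: l ∧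
      ∀ A ∈ B :: l, minObj f A ≤ minObj f ((scan (B, (minObj f B : WithTop ℝ)) l).result f) := by
  induction l generalizing B with
  | nil => simp [scan, OracleAlg.result]
  | cons A l ih =>
    simp only [scan, OracleAlg.result_andThen, result_evalMin f hm, WithTop.coe_lt_coe]
    split_ifs with h
    · obtain ⟨h1, h2⟩ := ih A
      refine ⟨List.mem_cons_of_mem _ h1, fun C hC => ?_⟩
      rcases List.mem_cons.1 hC with rfl | hC
      · exact h.le.trans (h2 A List.mem_cons_self)
      · exact h2 C hC
    · obtain ⟨h1, h2⟩ := ih B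
      refine ⟨?_, fun C hC => ?_⟩
      · rcases List.mem_cons.1 h1 with h1 | h1
        · rw [h1]
          exact List.mem_cons_self
        · exact List.mem_cons_of_mem _ (List.mem_cons_of_mem _ h1)
      · rcases List.mem_cons.1 hC with rfl | hC
        · exact h2 _ List.mem_cons_self
        rcases List.mem_cons.1 hC with rfl | hC
        · exact (not_lt.1 h).trans (h2 B List.mem_cons_self)
        · exact h2 C (List.mem_cons_of_mem _ hC)

variable [Fintype N] [DecidableEq N]

theorem mem_candidates {k' : ℕ} {S A : Finset N} :
    A ∈ candidates k' S ↔ ∃ X : Finset N, #X = k' ∧ Disjoint X S ∧ A = S ∪ X := by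
  simp only [candidates, List.mem_map, mem_toList, mem_powersetCard, subset_sdiff, subset_univ,
    true_and]
  exact ⟨fun ⟨X, h, e⟩ => ⟨X, h.2, h.1, e.symm⟩, fun ⟨X, h, h', e⟩ => ⟨X, ⟨h', h⟩, e.symm⟩⟩

theorem length_candidates (k' : ℕ) (S : Finset N) :
    (candidates k' S).length = (Fintype.card N - #S).choose k' := by
  simp [candidates, card_sdiff_of_subset (subset_univ S)]

theorem queries_greedyStep (k' : ℕ) (S : Finset N) :
    (greedyStep k' S).queries f = (Fintype.card N - #S).choose k' * m := by
  rw [← length_candidates]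
  unfold greedyStep
  split
  next h => simp [h, OracleAlg.queries]
  next A l h =>
    simp only [h, OracleAlg.queries_andThen, queries_evalMin, queries_scan, List.length_cons]
    ring

theorem result_greedyStep (hm : 1 ≤ m) {k' : ℕ} {S : Finset N} (h : candidates k' S ≠ []) :
    (greedyStep k' S).result f ∈ candidates k' S ∧
      ∀ A ∈ candidates k' S, minObj f A ≤ minObj f ((greedyStep k' S).result f) := by
  unfold greedyStep
  split
  next h' => exact absurd h' h
  next A l h' =>
    simp only [h', OracleAlg.result_andThen, result_evalMin f hm]
    exact result_scan f hm l A

/-- Unordered candidates save a factor `k'!` over ordered tuples, which pays for the `m` queries per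
candidate. -/
theorem queries_greedyStep_le {k' : ℕ} (hm : m ≤ k'.factorial) (S : Finset N) :
    (greedyStep k' S).queries f ≤ Fintype.card N ^ k' := by
  rw [queries_greedyStep]
  calc (Fintype.card N - #S).choose k' * m
      ≤ (Fintype.card N).choose k' * k'.factorial :=
        Nat.mul_le_mul (Nat.choose_le_choose _ (Nat.sub_le _ _)) hm
    _ = (Fintype.card N).descFactorial k' := by
        rw [Nat.descFactorial_eq_factorial_mul_choose, mul_comm]
    _ ≤ _ := Nat.descFactorial_le_pow _ _

theorem queries_greedyAlg_le {k' : ℕ} (hm : m ≤ k'.factorial) (T : ℕ) :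
    (greedyAlg k' T).queries f ≤ T * Fintype.card N ^ k' := by
  induction T with
  | zero => simp [greedyAlg, OracleAlg.queries]
  | succ T ih =>
    rw [greedyAlg, OracleAlg.queries_andThen, add_mul, one_mul]
    exact Nat.add_le_add ih (queries_greedyStep_le f hm _)

theorem isGreedyRun_greedyAlg (hm : 1 ≤ m) {k' T : ℕ} (hT : T * k' ≤ Fintype.card N) :
    IsGreedyRun f k' T fun j => (greedyAlg (m := m) k' j).result f := by
  induction T with
  | zero => exact ⟨rfl, by simp⟩
  | succ T ih =>
    have hrun := ih ((Nat.mul_le_mul_right _ T.le_succ).trans hT)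
    refine ⟨rfl, fun j hj => ?_⟩
    rcases Nat.lt_succ_iff_lt_or_eq.1 hj with hj | rfl
    · exact hrun.2 j hj
    set S := (greedyAlg (m := m) k' j).result f
    have hcard : #S + k' ≤ Fintype.card N := by
      rw [hrun.card_eq le_rfl]
      linarith
    -- Enough elements remain outside `S`, so the search does not hit the empty-list default.
    obtain ⟨Y, hY, hYS, -⟩ := exists_extension (X := ∅) (k' := k') (by simp) hcard
    obtain ⟨hmem, hbest⟩ := result_greedyStep f hm
      (List.ne_nil_of_mem (mem_candidates.2 ⟨Y, hY, hYS, rfl⟩))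
    obtain ⟨X, hX, hXS, hres⟩ := mem_candidates.1 hmem
    refine ⟨X, hX, hXS, ?_, fun Z hZ hZS => ?_⟩
    · rw [← hres]
      simp [greedyAlg, S]
    · rw [← hres]
      exact hbest _ (mem_candidates.2 ⟨Z, hZ, hZS, rfl⟩)

end Algorithm

theorem div_le_tupleSize (m : ℕ) (ε : ℝ) : (m : ℝ) / ε ^ 4 ≤ tupleSize m ε := Nat.le_ceil _

/-- For `m ≥ 2` the bound on `ε ln m` forces `ε ≤ 1`, hence `m ≤ m/ε⁴ ≤ k'`. For `m = 1`, where `ε`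
may be large, any factorial suffices. -/
theorem le_factorial_tupleSize {m : ℕ} (hm : 1 ≤ m) {ε : ℝ} (hε : 0 < ε)
    (hεm : 8 * ε * Real.log m < 1) : m ≤ (tupleSize m ε).factorial := by
  rcases hm.eq_or_lt with rfl | hm2
  · exact Nat.one_le_iff_ne_zero.2 (Nat.factorial_ne_zero _)
  refine le_trans ?_ (Nat.self_le_factorial _)
  have hlog : Real.log 2 ≤ Real.log m := Real.log_le_log (by norm_num) (by exact_mod_cast hm2)
  have hε1 : ε ≤ 1 := by
    by_contra! h
    nlinarith [Real.log_two_gt_d9]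
  have h : (m : ℝ) ≤ tupleSize m ε :=
    (le_div_self (Nat.cast_nonneg m) (by positivity) (pow_le_one₀ hε.le hε1)).trans
      (div_le_tupleSize m ε)
  exact_mod_cast h

end MultiSub

theorem theorem11 (m : ℕ) (hm : 1 ≤ m) (ε : ℝ) (hε : 0 < ε) (hεm : 8 * ε * Real.log m < 1) :
    ∃ K : ℕ, ∀ k : ℕ, K ≤ k →
      ∀ (N : Type*) [Fintype N] [DecidableEq N], k ≤ Fintype.card N →
      ∀ f : Fin m → Finset N → ℝ, (∀ i, MultiSub.IsMonotoneSubmodular (f i)) →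
        -- every greedy run, however ties are broken, is feasible and has the claimed value
        (∀ S : ℕ → Finset N,
          MultiSub.IsGreedyRun f (MultiSub.tupleSize m ε) (k / MultiSub.tupleSize m ε) S →
            (S (k / MultiSub.tupleSize m ε)).card ≤ k ∧
            (1 - 1 / Real.exp 1) * (1 - 2 * ε) * MultiSub.optValue f k ≤
              MultiSub.minObj f (S (k / MultiSub.tupleSize m ε))) ∧
        -- the deterministic value-oracle algorithm performs such a run
        MultiSub.IsGreedyRun f (MultiSub.tupleSize m ε) (k / MultiSub.tupleSize m ε)
          (fun j => (MultiSub.greedyAlg (m := m) (MultiSub.tupleSize m ε) j).result f) ∧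
        -- number of queries: in each step, and over all steps
        (∀ S : Finset N, (MultiSub.greedyStep (MultiSub.tupleSize m ε) S).queries f ≤
          Fintype.card N ^ MultiSub.tupleSize m ε) ∧
        (MultiSub.greedyAlg (MultiSub.tupleSize m ε) (k / MultiSub.tupleSize m ε)).queries f ≤
          (k / MultiSub.tupleSize m ε) * Fintype.card N ^ MultiSub.tupleSize m ε := by
  classical
  set k' := MultiSub.tupleSize m ε with hk'
  -- This `K` makes `k'/k ≤ ε/8`.
  refine ⟨⌈8 * (k' : ℝ) / ε⌉₊, fun k hk N _ _ hkN f hf => ?_⟩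
  have hkk : 8 * (k' : ℝ) ≤ ε * k := by
    have := Nat.ceil_le.1 hk
    rw [div_le_iff₀ hε] at this
    linarith
  have hfact := MultiSub.le_factorial_tupleSize hm hε hεm
  refine ⟨fun S hS => ⟨?_, ?_⟩, MultiSub.isGreedyRun_greedyAlg f hm
    ((Nat.div_mul_le_self k k').trans hkN), MultiSub.queries_greedyStep_le f hfact,
    MultiSub.queries_greedyAlg_le f hfact _⟩
  · rw [hS.card_eq le_rfl]
    exact Nat.div_mul_le_self k k'
  · rcases le_total ε (1 / 2) with hε2 | hε2
    · exact hS.le_minObj hm hf hε hε2 hεm (MultiSub.div_le_tupleSize m ε) hkk hkN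
    -- For `ε ≥ 1/2` the factor `1 - 2ε` is nonpositive and the bound is trivial.
    · have h1 : 0 ≤ 1 - 1 / Real.exp 1 := by
        rw [sub_nonneg, div_le_one (Real.exp_pos 1)]
        exact Real.one_le_exp zero_le_one
      refine le_trans ?_ (MultiSub.minObj_nonneg hm hf _)
      exact mul_nonpos_of_nonpos_of_nonneg
        (mul_nonpos_of_nonneg_of_nonpos h1 (by linarith)) (MultiSub.optValue_nonneg hm hf k)
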